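/- Let $a,b,g:[0,\infty)\to\mathbb R$ be Lebesgue measurable, with $a,b$ essentially bounded, and let $g^{-1}(E)$ have Lebesgue measure zero for every set $E$ of Lebesgue measure zero. Let $T\ge 0$ and suppose that for all $t\ge T$ $$0\le a_0\le a(t)\le A_0<1,\qquad 0<b_0\le b(t)\le B_0,\qquad 0\le t-g(t)\le\sigma,$$ where $a_0,A_0,b_0,B_0$ and $\sigma>0$ are constants. If $$\frac{\sigma A_0B_0^2(1-a_0)}{(1-A_0)^3\,b_0}<1,$$ then the equation $$\dot x(t)-a(t)\,\dot x(g(t))=-b(t)\,x(t)\qquad(t\ge T)$$ is uniformly exponentially stable: there are $M>0$ and $\gamma>0$ such that for every $t_0\ge T$, all bounded Borel measurable functions $\varphi:(-\infty,t_0]\to\mathbb R$ and $\psi:(-\infty,t_0)\to\mathbb R$, and every solution $x$ of the initial value problem $$\dot x(t)-a(t)\dot x(g(t))=-b(t)x(t),\ t\ge t_0,\qquad x(t)=\varphi(t),\ t\le t_0,\qquad \dot x(t)=\psi(t),\ t<t_0,$$ one has $$|x(t)|\le M e^{-\gamma(t-t_0)}\sup_{s\le t_0}\bigl(|\varphi(s)|+|\psi(s)|\bigr),\qquad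 t\ge t_0,$$ where $\psi(t_0)$ is read as $0$. Here a solution is a function $x:\mathbb R\to\mathbb R$ that is locally absolutely continuous on $[t_0,\infty)$ with locally essentially bounded derivative there, that equals $\varphi$ on $(-\infty,t_0]$, and that satisfies the equation for almost all $t\ge t_0$, where $\dot x(g(t))$ means $\psi(g(t))$ if $g(t)<t_0$ ($\varphi$ and $\psi$ are independent data). -/

import Mathlib

open MeasureTheory Set

/-- `IsNeutralSolution a b g h f t₀ φ ψ x`: the function `x : ℝ → ℝ` is a solution of the initial
value problem
`x'(t) - a(t) x'(g(t)) + b(t) x(h(t)) = f(t)` for `t ≥ t₀`, `x(t) = φ(t)` for `t ≤ t₀`,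
`x'(t) = ψ(t)` for `t < t₀`.
As usual for neutral equations, `φ` and `ψ` are independent data: `ψ(g(t))` takes the place of
`x'(g(t))` whenever `g(t) < t₀`. Solutions are locally absolutely continuous on `[t₀, ∞)` with a
locally essentially bounded derivative, the class in which the problem is uniquely solvable. -/
structure IsNeutralSolution (a b g h f : ℝ → ℝ) (t₀ : ℝ) (φ ψ x : ℝ → ℝ) : Prop where
  /-- `x` is locally absolutely continuous on `[t₀, ∞)`. -/
  absolutelyContinuous : ∀ t₁, t₀ ≤ t₁ → AbsolutelyContinuousOnInterval x t₀ t₁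
  /-- The derivative of `x` is essentially bounded on bounded subintervals of `[t₀, ∞)`. -/
  deriv_bounded : ∀ t₁, t₀ ≤ t₁ →
    ∃ C : ℝ, ∀ᵐ t ∂(volume.restrict (Icc t₀ t₁)), |deriv x t| ≤ C
  /-- The equation holds almost everywhere on `[t₀, ∞)`. -/
  equation : ∀ᵐ t ∂(volume.restrict (Ici t₀)),
    deriv x t - a t * (if g t < t₀ then ψ (g t) else deriv x (g t)) + b t * x (h t) = f t
  /-- The initial condition. -/
  initial : ∀ t, t ≤ t₀ → x t = φ t

/-- Uniform exponential stability of `x'(t) - a(t) x'(g(t)) = -b(t) x(h(t))`, considered for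
`t ≥ T`: one pair of constants `M, γ > 0` serves all initial points `t₀ ≥ T` and all bounded Borel
initial data `φ` on `(-∞, t₀]` and `ψ` on `(-∞, t₀)`. In the supremum the undefined
value `ψ(t₀)` is read as `0`. -/
def UniformlyExponentiallyStable (a b g h : ℝ → ℝ) (T : ℝ) : Prop :=
  ∃ M γ : ℝ, 0 < M ∧ 0 < γ ∧
    ∀ (t₀ : ℝ), T ≤ t₀ → ∀ (φ ψ : ℝ → ℝ),
      Measurable (fun s : Iic t₀ => φ s) → Measurable (fun s : Iio t₀ => ψ s) →
      (∃ C : ℝ, ∀ t, t ≤ t₀ → |φ t| ≤ C) → (∃ C : ℝ, ∀ t, t < t₀ → |ψ t| ≤ C) →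
      ∀ x : ℝ → ℝ, IsNeutralSolution a b g h (fun _ => 0) t₀ φ ψ x →
        ∀ t, t₀ ≤ t →
          |x t| ≤ M * Real.exp (-γ * (t - t₀)) *
            (⨆ s : Iic t₀, (|φ s| + |(Iio t₀).indicator ψ s|))

/-! Let `B` solve `B = b + a * B ∘ g` on `[t₀, ∞)`, with `β = b₀ / (1 - a₀) ≤ B ≤ B₁ = B₀ / (1 -
A₀)`. Away from the initial data, `w = x' + B x` then satisfies `w(t) = a(t) w(g(t)) + a(t) B(g(t))
(x(t) - x(g(t)))`: the undelayed term is absorbed into `B`, and only an increment of `x` over a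
length at most `σ` remains.

Up to initial data, this gives in sup norms `|x'| ≤ B₀|x| / (1 - A₀)` from the equation, `|w| ≤ A₀
B₁ σ |x'| / (1 - A₀)` from the identity, and `|x| ≤ |w| / β` from `x' + B x = w`. The product of the
three factors is the constant assumed less than 1, so the loop closes.

For decay, every norm carries the weight `exp (γ (t - t₀))`. Each delay then costs at most a factor
`exp (γ σ)`, and the strict inequality survives for small `γ > 0`. -/

/-- An a.e. bound that can be improved by the affine contraction `C ↦ q * C + d` can be replaced by
the fixed point of this contraction. -/
theorem ae_abs_le_of_contraction {α : Type*} [MeasurableSpace α] {μ : Measure α} {f : α → ℝ}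
    {q d C₀ : ℝ} (hq₀ : 0 ≤ q) (hq₁ : q < 1) (h₀ : ∀ᵐ t ∂μ, |f t| ≤ C₀)
    (hstep : ∀ C, (∀ᵐ t ∂μ, |f t| ≤ C) → ∀ᵐ t ∂μ, |f t| ≤ q * C + d) :
    ∀ᵐ t ∂μ, |f t| ≤ d / (1 - q) := by
  have hne : 1 - q ≠ 0 := by linarith
  have hn : ∀ n : ℕ, ∀ᵐ t ∂μ, |f t| ≤ q ^ n * (C₀ - d / (1 - q)) + d / (1 - q) := by
    intro n
    induction n with
    | zero => simpa using h₀
    | succ n ih =>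
      filter_upwards [hstep _ ih] with t ht
      refine ht.trans_eq ?_
      field_simp
      ring
  filter_upwards [ae_all_iff.2 hn] with t ht
  have hlim : Filter.Tendsto (fun n : ℕ => q ^ n * (C₀ - d / (1 - q)) + d / (1 - q)) Filter.atTop
      (nhds (0 * (C₀ - d / (1 - q)) + d / (1 - q))) :=
    ((tendsto_pow_atTop_nhds_zero_of_lt_one hq₀ hq₁).mul_const _).add_const _
  rw [zero_mul, zero_add] at hlim
  exact ge_of_tendsto' hlim ht

/-- An absolutely continuous function that starts below the level `R` and does not increase above
this level stays below it. -/
theorem AbsolutelyContinuousOnInterval.le_of_deriv_nonpos_above {u : ℝ → ℝ} {p r R : ℝ}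
    (hpr : p ≤ r) (hu : AbsolutelyContinuousOnInterval u p r) (hp : u p ≤ R)
    (hd : ∀ᵐ t ∂(volume.restrict (Icc p r)), R ≤ u t → deriv u t ≤ 0) : u r ≤ R := by
  by_contra! hr
  have hcont : ContinuousOn u (Icc p r) := by simpa [uIcc_of_le hpr] using hu.continuousOn
  have hclosed : IsClosed (Icc p r ∩ u ⁻¹' Iic R) :=
    hcont.preimage_isClosed_of_isClosed isClosed_Icc isClosed_Iic
  have hcomp : IsCompact (Icc p r ∩ u ⁻¹' Iic R) :=
    isCompact_Icc.of_isClosed_subset hclosed inter_subset_left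
  -- `s` is the last point where `u ≤ R`; beyond it `u` exceeds `R` and cannot increase.
  obtain ⟨s, ⟨hs, hsR⟩, hmax⟩ :=
    hcomp.exists_isGreatest ⟨p, ⟨le_refl p, hpr⟩, hp⟩
  have hsr : s ≤ r := hs.2
  have hac : AbsolutelyContinuousOnInterval u s r :=
    hu.mono (by rw [uIcc_of_le hpr, uIcc_of_le hsr]; exact Icc_subset_Icc_left hs.1)
  have hint := hac.integral_deriv_eq_sub
  have hle : ∫ t in s..r, deriv u t ≤ 0 := by
    rw [intervalIntegral.integral_of_le hsr]
    refine integral_nonpos_of_ae ?_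
    have hsub : Ioc s r ⊆ Icc p r := fun t ht => ⟨hs.1.trans ht.1.le, ht.2⟩
    filter_upwards [ae_restrict_of_ae_restrict_of_subset hsub hd,
      ae_restrict_mem measurableSet_Ioc] with t ht hts
    refine ht ?_
    by_contra! hlt
    exact absurd (hmax ⟨hsub hts, hlt.le⟩) (not_le.2 hts.1)
  have : u s ≤ R := hsR
  linarith

/-- Exponentially weighted bound for `x' + B x = w` with `B ≥ β` and `w` decaying. -/
theorem abs_exp_mul_le_of_ae_deriv {x B : ℝ → ℝ} {t₀ t₁ β γ W Φ : ℝ} (ht : t₀ ≤ t₁)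
    (hx : AbsolutelyContinuousOnInterval x t₀ t₁) (hβ : γ < β) (h₀ : |x t₀| ≤ Φ) (hΦ : 0 ≤ Φ)
    (hW : 0 ≤ W) (hB : ∀ t, t₀ ≤ t → β ≤ B t)
    (hw : ∀ᵐ t ∂(volume.restrict (Icc t₀ t₁)),
      |Real.exp (γ * (t - t₀)) * (deriv x t + B t * x t)| ≤ W) :
    |Real.exp (γ * (t₁ - t₀)) * x t₁| ≤ Φ + W / (β - γ) := by
  have key : ∀ y : ℝ → ℝ, AbsolutelyContinuousOnInterval y t₀ t₁ → y t₀ ≤ Φ →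
      (∀ᵐ t ∂(volume.restrict (Icc t₀ t₁)),
        Real.exp (γ * (t - t₀)) * (deriv y t + B t * y t) ≤ W) →
      Real.exp (γ * (t₁ - t₀)) * y t₁ ≤ Φ + W / (β - γ) := by
    intro y hy hy₀ hyw
    have hdiv : 0 ≤ W / (β - γ) := div_nonneg hW (by linarith)
    have hexp : AbsolutelyContinuousOnInterval (fun t => Real.exp (γ * (t - t₀))) t₀ t₁ :=
      ContDiffOn.absolutelyContinuousOnInterval (by fun_prop)
    refine AbsolutelyContinuousOnInterval.le_of_deriv_nonpos_above
      (u := fun t => Real.exp (γ * (t - t₀)) * y t) ht (hexp.fun_mul hy) ?_ ?_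
    · simp only [sub_self, mul_zero, Real.exp_zero, one_mul]
      linarith
    · have hdiff := (ae_restrict_iff' measurableSet_Icc).2
        (by simpa [uIcc_of_le ht] using hy.ae_differentiableAt)
      filter_upwards [hyw, hdiff, ae_restrict_mem measurableSet_Icc] with t htw htd htm hR
      have hE : HasDerivAt (fun t => Real.exp (γ * (t - t₀)))
          (Real.exp (γ * (t - t₀)) * (γ * 1)) t :=
        (((hasDerivAt_id t).sub_const t₀).const_mul γ).exp
      rw [(hE.fun_mul htd.hasDerivAt).deriv]
      -- The weighted function `u` satisfies `u' ≤ W - (B - γ) u`, which is nonpositive once `u ≥ W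
      -- / (β - γ)`.
      have h1 : W ≤ (β - γ) * (Real.exp (γ * (t - t₀)) * y t) := by
        have : W / (β - γ) ≤ Real.exp (γ * (t - t₀)) * y t := by linarith
        rwa [div_le_iff₀' (by linarith)] at this
      have h2 : 0 ≤ (B t - β) * (Real.exp (γ * (t - t₀)) * y t) :=
        mul_nonneg (by linarith [hB t htm.1]) (by linarith)
      linarith
  rw [abs_le]
  constructor
  · have := key (fun t => -x t) hx.fun_neg (by linarith [neg_abs_le (x t₀)])
      (by
        filter_upwards [hw] with t htw
        rw [deriv.fun_neg]
        linarith [neg_abs_le (Real.exp (γ * (t - t₀)) * (deriv x t + B t * x t))])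
    linarith
  · exact key x hx (by linarith [le_abs_self (x t₀)])
      (by filter_upwards [hw] with t htw using (le_abs_self _).trans htw)

/-- Increments over intervals of length at most `σ` of a function with exponentially decaying
derivative. -/
theorem exp_mul_abs_sub_le {x : ℝ → ℝ} {t₀ t₁ s t γ σ Y : ℝ} (hγ : 0 ≤ γ) (hY : 0 ≤ Y)
    (hx : AbsolutelyContinuousOnInterval x t₀ t₁)
    (hy : ∀ᵐ t ∂(volume.restrict (Icc t₀ t₁)), |Real.exp (γ * (t - t₀)) * deriv x t| ≤ Y)
    (hs : t₀ ≤ s) (hst : s ≤ t) (ht : t ≤ t₁) (hσ : t - s ≤ σ) :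
    Real.exp (γ * (t - t₀)) * |x t - x s| ≤ Real.exp (γ * σ) * (σ * Y) := by
  have h₀₁ : t₀ ≤ t₁ := hs.trans (hst.trans ht)
  have hac : AbsolutelyContinuousOnInterval x s t :=
    hx.mono (by rw [uIcc_of_le h₀₁, uIcc_of_le hst]; exact Icc_subset_Icc hs ht)
  have hbound : |x t - x s| ≤ Real.exp (-(γ * (s - t₀))) * Y * |t - s| := by
    rw [← hac.integral_deriv_eq_sub, ← Real.norm_eq_abs]
    refine intervalIntegral.norm_integral_le_of_norm_le_const_ae ?_
    filter_upwards [(ae_restrict_iff' measurableSet_Icc).1 hy] with r hr hrm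
    rw [uIoc_of_le hst] at hrm
    have h := hr ⟨hs.trans hrm.1.le, hrm.2.trans ht⟩
    rw [abs_mul, abs_of_pos (Real.exp_pos _)] at h
    rw [Real.norm_eq_abs]
    calc |deriv x r| = Real.exp (-(γ * (r - t₀))) * (Real.exp (γ * (r - t₀)) * |deriv x r|) := by
          rw [← mul_assoc, ← Real.exp_add]; simp
      _ ≤ Real.exp (-(γ * (s - t₀))) * Y := by
          have : s ≤ r := hrm.1.le
          gcongr
  rw [abs_of_nonneg (sub_nonneg.2 hst)] at hbound
  calc Real.exp (γ * (t - t₀)) * |x t - x s|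
      ≤ Real.exp (γ * (t - t₀)) * (Real.exp (-(γ * (s - t₀))) * Y * (t - s)) := by gcongr
    _ = Real.exp (γ * (t - s)) * ((t - s) * Y) := by
        rw [show γ * (t - s) = γ * (t - t₀) + -(γ * (s - t₀)) by ring, Real.exp_add]; ring
    _ ≤ Real.exp (γ * σ) * (σ * Y) := by
        have : 0 ≤ t - s := sub_nonneg.2 hst
        gcongr

/-- Almost everywhere properties pull back along a map under which preimages of null sets are
null. -/
theorem ae_restrict_comp_of_null_preimage {g : ℝ → ℝ} {S : Set ℝ} {t₀ t₁ : ℝ} (ht₀ : Ici t₀ ⊆ S)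
    (hg : ∀ E : Set ℝ, volume E = 0 → volume (g ⁻¹' E ∩ S) = 0) {P : ℝ → Prop}
    (hP : ∀ᵐ t ∂(volume.restrict (Icc t₀ t₁)), P t) :
    ∀ᵐ t ∂(volume.restrict (Icc t₀ t₁)), g t ∈ Icc t₀ t₁ → P (g t) := by
  rw [ae_restrict_iff' measurableSet_Icc] at hP ⊢
  have h := hg _ (ae_iff.1 hP)
  rw [ae_iff]
  refine measure_mono_null ?_ h
  intro t ht
  simp only [mem_ofPred_eq, Classical.not_imp] at ht
  refine ⟨?_, ht₀ ht.1.1⟩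
  simp only [mem_preimage, mem_ofPred_eq, Classical.not_imp]
  exact ht.2

/-! ### The auxiliary coefficient `B` -/

/-- The functional equation `B = b + a * B ∘ g` on `[t₀, ∞)` has a solution on `ℝ` between
`b₀ / (1 - a₀)` and `B₀ / (1 - A₀)`. -/
theorem exists_bounded_solution_functional_equation {a b g : ℝ → ℝ} {t₀ a₀ A₀ b₀ B₀ : ℝ}
    (ha₀ : 0 ≤ a₀) (hA₀ : A₀ < 1) (ha : ∀ t, t₀ ≤ t → a₀ ≤ a t ∧ a t ≤ A₀)
    (hb₀ : 0 < b₀) (hb : ∀ t, t₀ ≤ t → b₀ ≤ b t ∧ b t ≤ B₀) :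
    ∃ B : ℝ → ℝ, (∀ t, t₀ ≤ t → B t = b t + a t * B (g t)) ∧
      ∀ t, b₀ / (1 - a₀) ≤ B t ∧ B t ≤ B₀ / (1 - A₀) := by
  have haA : a₀ ≤ A₀ := (ha t₀ le_rfl).1.trans (ha t₀ le_rfl).2
  have hbB : b₀ ≤ B₀ := (hb t₀ le_rfl).1.trans (hb t₀ le_rfl).2
  set β := b₀ / (1 - a₀) with hβ
  set K := B₀ / (1 - A₀) with hK
  have hβ₀ : 0 ≤ β := div_nonneg hb₀.le (by linarith)
  have hβe : b₀ + a₀ * β = β := by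
    have : 1 - a₀ ≠ 0 := by linarith
    rw [hβ]; field_simp; ring
  have hKe : B₀ + A₀ * K = K := by
    have : 1 - A₀ ≠ 0 := by linarith
    rw [hK]; field_simp; ring
  have hβK : β ≤ K := div_le_div₀ (by linarith) hbB (by linarith) (by linarith)
  -- Since `a ≥ 0`, iterating `F` from the constant `β` increases pointwise and stays below `K`. The
  -- value `β` left of `t₀` matters because `g t` may fall there.
  let F : (ℝ → ℝ) → ℝ → ℝ := fun B t => if t₀ ≤ t then b t + a t * B (g t) else β
  let u : ℕ → ℝ → ℝ := fun n => F^[n] (fun _ => β)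
  have hu : ∀ n, u (n + 1) = F (u n) := fun n => Function.iterate_succ_apply' F n _
  have hmono : ∀ n t, β ≤ u n t ∧ u n t ≤ u (n + 1) t ∧ u n t ≤ K := by
    intro n
    induction n with
    | zero =>
      intro t
      refine ⟨le_rfl, ?_, hβK⟩
      rw [hu]
      show β ≤ if t₀ ≤ t then b t + a t * β else β
      split_ifs with h
      · nlinarith [ha t h, hb t h]
      · exact le_rfl
    | succ n ih =>
      intro t
      refine ⟨(ih t).1.trans (ih t).2.1, ?_, ?_⟩
      · rw [hu (n + 1)]
        nth_rw 1 [hu n]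
        show (if t₀ ≤ t then b t + a t * u n (g t) else β) ≤
          if t₀ ≤ t then b t + a t * u (n + 1) (g t) else β
        split_ifs with h
        · have := mul_le_mul_of_nonneg_left (ih (g t)).2.1 (ha₀.trans (ha t h).1)
          linarith
        · exact le_rfl
      · rw [hu n]
        show (if t₀ ≤ t then b t + a t * u n (g t) else β) ≤ K
        split_ifs with h
        · have := mul_le_mul (ha t h).2 (ih (g t)).2.2 (hβ₀.trans (ih (g t)).1) (by linarith)
          linarith [(hb t h).2]
        · exact hβK
  have hlim : ∀ t, Filter.Tendsto (fun n => u n t) Filter.atTop (nhds (⨆ n, u n t)) := fun t =>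
    tendsto_atTop_ciSup (monotone_nat_of_le_succ fun n => (hmono n t).2.1)
      ⟨K, by rintro _ ⟨n, rfl⟩; exact (hmono n t).2.2⟩
  refine ⟨fun t => ⨆ n, u n t, ?_, ?_⟩
  · intro t ht
    refine tendsto_nhds_unique ((hlim t).comp (Filter.tendsto_add_atTop_nat 1)) ?_
    have : (fun n => u n t) ∘ (fun n => n + 1) = fun n => b t + a t * u n (g t) := by
      funext n
      show u (n + 1) t = _
      rw [hu]
      exact if_pos ht
    rw [this]
    exact ((hlim (g t)).const_mul _).const_add _
  · exact fun t => ⟨ge_of_tendsto' (hlim t) fun n => (hmono n t).1,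
      le_of_tendsto' (hlim t) fun n => (hmono n t).2.2⟩

/-! ### Weighted a priori bounds -/

/-- A priori bound for the exponentially weighted derivative of a solution. -/
theorem IsNeutralSolution.ae_exp_mul_deriv_le {a b g φ ψ x : ℝ → ℝ}
    {t₀ t₁ A₀ B₀ σ γ Φ X : ℝ} (ht₀ : 0 ≤ t₀)
    (ha : ∀ t, t₀ ≤ t → 0 ≤ a t ∧ a t ≤ A₀) (hb : ∀ t, t₀ ≤ t → 0 ≤ b t ∧ b t ≤ B₀)
    (hg_null : ∀ E : Set ℝ, volume E = 0 → volume (g ⁻¹' E ∩ Ici 0) = 0)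
    (hg : ∀ t, t₀ ≤ t → 0 ≤ t - g t ∧ t - g t ≤ σ)
    (hγ : 0 ≤ γ) (hq : A₀ * Real.exp (γ * σ) < 1) (ht : t₀ ≤ t₁)
    (hψ : ∀ s, s < t₀ → |ψ s| ≤ Φ)
    (hx : IsNeutralSolution a b g (fun t => t) (fun _ => 0) t₀ φ ψ x)
    (hX : ∀ t ∈ Icc t₀ t₁, Real.exp (γ * (t - t₀)) * |x t| ≤ X) :
    ∀ᵐ t ∂(volume.restrict (Icc t₀ t₁)), |Real.exp (γ * (t - t₀)) * deriv x t| ≤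
      (B₀ * X + A₀ * Real.exp (γ * σ) * Φ) / (1 - A₀ * Real.exp (γ * σ)) := by
  have hA₀' : 0 ≤ A₀ := (ha t₀ le_rfl).1.trans (ha t₀ le_rfl).2
  have hB₀' : 0 ≤ B₀ := (hb t₀ le_rfl).1.trans (hb t₀ le_rfl).2
  have hΦ : 0 ≤ Φ := (abs_nonneg _).trans (hψ (t₀ - 1) (by linarith))
  obtain ⟨C₁, hC₁⟩ := hx.deriv_bounded t₁ ht
  refine ae_abs_le_of_contraction (C₀ := Real.exp (γ * (t₁ - t₀)) * C₁) (by positivity) hq ?_ ?_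
  · filter_upwards [hC₁, ae_restrict_mem measurableSet_Icc] with t h1 htm
    rw [abs_mul, abs_of_pos (Real.exp_pos _)]
    have := htm.2
    gcongr
  intro C hC
  -- For `t₀ = t₁` the interval is null and `C` may be negative.
  have hC₀ : 0 ≤ C ∨ volume.restrict (Icc t₀ t₁) = 0 := by
    by_contra! h
    have : (ae (volume.restrict (Icc t₀ t₁))).NeBot := ae_neBot.2 h.2
    obtain ⟨t, h3⟩ := hC.exists
    linarith [abs_nonneg (Real.exp (γ * (t - t₀)) * deriv x t)]
  rcases hC₀ with hC₀ | h0
  swap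
  · rw [h0]; simp
  filter_upwards [ae_restrict_of_ae_restrict_of_subset Icc_subset_Ici_self hx.equation,
    ae_restrict_comp_of_null_preimage (Ici_subset_Ici.2 ht₀) hg_null hC,
    ae_restrict_mem measurableSet_Icc] with t heq hgt htm
  have hxt : Real.exp (γ * (t - t₀)) * |b t * x t| ≤ B₀ * X := by
    rw [abs_mul, abs_of_nonneg (hb t htm.1).1]
    calc Real.exp (γ * (t - t₀)) * (b t * |x t|) = b t * (Real.exp (γ * (t - t₀)) * |x t|) := by
          ring
      _ ≤ B₀ * X := mul_le_mul (hb t htm.1).2 (hX t htm) (by positivity) hB₀'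
  have hgσ := hg t htm.1
  set z := if g t < t₀ then ψ (g t) else deriv x (g t) with hz
  have hzt : Real.exp (γ * (t - t₀)) * |z| ≤ Real.exp (γ * σ) * (C + Φ) := by
    rw [hz]
    split_ifs with h
    · have h1 : t - t₀ ≤ σ := by linarith
      have h2 : |ψ (g t)| ≤ C + Φ := (hψ _ h).trans (by linarith)
      gcongr
    · rw [not_lt] at h
      have h1 := hgt ⟨h, by linarith [htm.2]⟩
      rw [abs_mul, abs_of_pos (Real.exp_pos _)] at h1
      calc Real.exp (γ * (t - t₀)) * |deriv x (g t)|
          = Real.exp (γ * (t - g t)) * (Real.exp (γ * (g t - t₀)) * |deriv x (g t)|) := by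
            rw [← mul_assoc, ← Real.exp_add]; ring_nf
        _ ≤ Real.exp (γ * σ) * (C + Φ) := by
            have := hgσ.2
            gcongr
            linarith
  have hy : deriv x t = a t * z - b t * x t := by linarith
  rw [hy, abs_mul, abs_of_pos (Real.exp_pos _)]
  calc Real.exp (γ * (t - t₀)) * |a t * z - b t * x t|
      ≤ Real.exp (γ * (t - t₀)) * (|a t * z| + |b t * x t|) := by gcongr; exact abs_sub _ _
    _ = a t * (Real.exp (γ * (t - t₀)) * |z|) + Real.exp (γ * (t - t₀)) * |b t * x t| := by
        rw [abs_mul, abs_of_nonneg (ha t htm.1).1]; ring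
    _ ≤ A₀ * (Real.exp (γ * σ) * (C + Φ)) + B₀ * X :=
        add_le_add (mul_le_mul (ha t htm.1).2 hzt (by positivity) hA₀') hxt
    _ = _ := by ring

/-- A priori bound for the exponentially weighted function `x' + B x`, where `x` is a solution and
`B = b + a * B ∘ g`. -/
theorem IsNeutralSolution.ae_exp_mul_deriv_add_le {a b g φ ψ x B : ℝ → ℝ}
    {t₀ t₁ A₀ B₁ σ γ Φ X Y : ℝ} (ht₀ : 0 ≤ t₀)
    (ha : ∀ t, t₀ ≤ t → 0 ≤ a t ∧ a t ≤ A₀)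
    (hg_null : ∀ E : Set ℝ, volume E = 0 → volume (g ⁻¹' E ∩ Ici 0) = 0)
    (hg : ∀ t, t₀ ≤ t → 0 ≤ t - g t ∧ t - g t ≤ σ)
    (hγ : 0 ≤ γ) (hq : A₀ * Real.exp (γ * σ) < 1) (ht : t₀ ≤ t₁)
    (hφ : |φ t₀| ≤ Φ) (hψ : ∀ s, s < t₀ → |ψ s| ≤ Φ)
    (hx : IsNeutralSolution a b g (fun t => t) (fun _ => 0) t₀ φ ψ x)
    (hX : ∀ t ∈ Icc t₀ t₁, Real.exp (γ * (t - t₀)) * |x t| ≤ X) (hY : 0 ≤ Y)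
    (hxY : ∀ᵐ t ∂(volume.restrict (Icc t₀ t₁)), |Real.exp (γ * (t - t₀)) * deriv x t| ≤ Y)
    (hB : ∀ t, t₀ ≤ t → B t = b t + a t * B (g t)) (hB₁ : ∀ t, 0 ≤ B t ∧ B t ≤ B₁) :
    ∀ᵐ t ∂(volume.restrict (Icc t₀ t₁)),
      |Real.exp (γ * (t - t₀)) * (deriv x t + B t * x t)| ≤
        A₀ * Real.exp (γ * σ) * (B₁ * (σ * Y) + (1 + B₁) * Φ) /
          (1 - A₀ * Real.exp (γ * σ)) := by
  have hA₀' : 0 ≤ A₀ := (ha t₀ le_rfl).1.trans (ha t₀ le_rfl).2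
  have hB₁' : 0 ≤ B₁ := (hB₁ t₀).1.trans (hB₁ t₀).2
  have hΦ : 0 ≤ Φ := (abs_nonneg _).trans hφ
  have hac := hx.absolutelyContinuous t₁ ht
  refine ae_abs_le_of_contraction (C₀ := Y + B₁ * X) (by positivity) hq ?_ ?_
  · filter_upwards [hxY, ae_restrict_mem measurableSet_Icc] with t h1 htm
    rw [mul_add]
    refine (abs_add_le _ _).trans (add_le_add h1 ?_)
    rw [abs_mul, abs_mul, abs_of_pos (Real.exp_pos _), abs_of_nonneg (hB₁ t).1]
    calc Real.exp (γ * (t - t₀)) * (B t * |x t|) = B t * (Real.exp (γ * (t - t₀)) * |x t|) := by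
          ring
      _ ≤ B₁ * X := mul_le_mul (hB₁ t).2 (hX t htm) (by positivity) hB₁'
  intro C hC
  have hC₀ : 0 ≤ C ∨ volume.restrict (Icc t₀ t₁) = 0 := by
    by_contra! h
    have : (ae (volume.restrict (Icc t₀ t₁))).NeBot := ae_neBot.2 h.2
    obtain ⟨t, h3⟩ := hC.exists
    linarith [abs_nonneg (Real.exp (γ * (t - t₀)) * (deriv x t + B t * x t))]
  rcases hC₀ with hC₀ | h0
  swap
  · rw [h0]; simp
  filter_upwards [ae_restrict_of_ae_restrict_of_subset Icc_subset_Ici_self hx.equation,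
    ae_restrict_comp_of_null_preimage (Ici_subset_Ici.2 ht₀) hg_null hC,
    ae_restrict_mem measurableSet_Icc] with t heq hgt htm
  have hgσ := hg t htm.1
  have hat := ha t htm.1
  have hBg := hB₁ (g t)
  -- If `g t ≥ t₀`, then `u = w(g t)` and `v` is the increment of `x`. If `g t < t₀`, then `u = ψ (g
  -- t)` and `v = x t`, which is close to `φ t₀` because `t - t₀ ≤ σ`.
  suffices h : ∃ u v : ℝ, deriv x t + B t * x t = a t * (u + B (g t) * v) ∧
      Real.exp (γ * (t - t₀)) * |u| ≤ Real.exp (γ * σ) * (C + Φ) ∧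
      Real.exp (γ * (t - t₀)) * |v| ≤ Real.exp (γ * σ) * (σ * Y + Φ) by
    obtain ⟨u, v, huv, hu, hv⟩ := h
    rw [huv, abs_mul, abs_of_pos (Real.exp_pos _), abs_mul, abs_of_nonneg hat.1]
    have h1 : Real.exp (γ * (t - t₀)) * |u + B (g t) * v| ≤
        Real.exp (γ * σ) * (C + Φ) + B₁ * (Real.exp (γ * σ) * (σ * Y + Φ)) :=
      calc Real.exp (γ * (t - t₀)) * |u + B (g t) * v|
          ≤ Real.exp (γ * (t - t₀)) * (|u| + |B (g t) * v|) := by gcongr; exact abs_add_le _ _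
        _ = Real.exp (γ * (t - t₀)) * |u| + B (g t) * (Real.exp (γ * (t - t₀)) * |v|) := by
            rw [abs_mul, abs_of_nonneg hBg.1]; ring
        _ ≤ _ := add_le_add hu (mul_le_mul hBg.2 hv (by positivity) hB₁')
    calc Real.exp (γ * (t - t₀)) * (a t * |u + B (g t) * v|)
        = a t * (Real.exp (γ * (t - t₀)) * |u + B (g t) * v|) := by ring
      _ ≤ A₀ * (Real.exp (γ * σ) * (C + Φ) + B₁ * (Real.exp (γ * σ) * (σ * Y + Φ))) :=
          mul_le_mul hat.2 h1 (by positivity) hA₀'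
      _ = _ := by ring
  rcases lt_or_ge (g t) t₀ with h | h
  · rw [if_pos h] at heq
    refine ⟨ψ (g t), x t, ?_, ?_, ?_⟩
    · rw [hB t htm.1]; linarith
    · have h1 : t - t₀ ≤ σ := by linarith
      have h2 : |ψ (g t)| ≤ C + Φ := (hψ _ h).trans (by linarith)
      gcongr
    · have h1 : t - t₀ ≤ σ := by linarith
      have h2 := exp_mul_abs_sub_le hγ hY hac hxY le_rfl htm.1 htm.2 h1
      have h3 : |x t₀| ≤ Φ := by rwa [hx.initial t₀ le_rfl]
      have h4 : Real.exp (γ * (t - t₀)) * |x t₀| ≤ Real.exp (γ * σ) * Φ := by gcongr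
      calc Real.exp (γ * (t - t₀)) * |x t|
          ≤ Real.exp (γ * (t - t₀)) * (|x t - x t₀| + |x t₀|) := by
            gcongr
            simpa using abs_add_le (x t - x t₀) (x t₀)
        _ ≤ _ := by linarith
  · rw [if_neg (not_lt.2 h)] at heq
    refine ⟨deriv x (g t) + B (g t) * x (g t), x t - x (g t), ?_, ?_, ?_⟩
    · rw [hB t htm.1]; linarith
    · have h1 := hgt ⟨h, by linarith [htm.2]⟩
      rw [abs_mul, abs_of_pos (Real.exp_pos _)] at h1
      calc Real.exp (γ * (t - t₀)) * |deriv x (g t) + B (g t) * x (g t)|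
          = Real.exp (γ * (t - g t)) *
              (Real.exp (γ * (g t - t₀)) * |deriv x (g t) + B (g t) * x (g t)|) := by
            rw [← mul_assoc, ← Real.exp_add]; ring_nf
        _ ≤ Real.exp (γ * σ) * (C + Φ) := by
            have := hgσ.2
            gcongr
            linarith
    · refine (exp_mul_abs_sub_le hγ hY hac hxY h (by linarith) htm.2 hgσ.2).trans ?_
      gcongr
      linarith

/-! ### Closing the loop -/

theorem corollary2
    (a b g : ℝ → ℝ) (T a₀ A₀ b₀ B₀ σ : ℝ) (hT : 0 ≤ T)
    -- Lebesgue measurable coefficients and delay, essentially bounded coefficients on `[0, ∞)`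
    (ha_meas : AEMeasurable a (volume.restrict (Ici 0)))
    (hb_meas : AEMeasurable b (volume.restrict (Ici 0)))
    (hg_meas : AEMeasurable g (volume.restrict (Ici 0)))
    (ha_bdd : ∃ C : ℝ, ∀ᵐ t ∂(volume.restrict (Ici (0 : ℝ))), |a t| ≤ C)
    (hb_bdd : ∃ C : ℝ, ∀ᵐ t ∂(volume.restrict (Ici (0 : ℝ))), |b t| ≤ C)
    -- bounds on the coefficients for `t ≥ T`
    (ha₀ : 0 ≤ a₀) (hA₀ : A₀ < 1) (ha : ∀ t, T ≤ t → a₀ ≤ a t ∧ a t ≤ A₀)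
    (hb₀ : 0 < b₀) (hb : ∀ t, T ≤ t → b₀ ≤ b t ∧ b t ≤ B₀)
    -- preimages of null sets under `g : [0, ∞) → ℝ` are null sets
    (hg_null : ∀ E : Set ℝ, volume E = 0 → volume (g ⁻¹' E ∩ Ici 0) = 0)
    -- the delay is nonnegative and bounded for `t ≥ T`
    (hσ : 0 < σ) (hg : ∀ t, T ≤ t → 0 ≤ t - g t ∧ t - g t ≤ σ)
    (hmain : σ * A₀ * B₀ ^ 2 * (1 - a₀) / ((1 - A₀) ^ 3 * b₀) < 1) :
    UniformlyExponentiallyStable a b g (fun t => t) T := by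
  have haA : a₀ ≤ A₀ := (ha T le_rfl).1.trans (ha T le_rfl).2
  have hbB : b₀ ≤ B₀ := (hb T le_rfl).1.trans (hb T le_rfl).2
  have h1a : 0 < 1 - a₀ := by linarith
  have h1A : 0 < 1 - A₀ := by linarith
  have hB₀ : 0 < B₀ := by linarith
  have hA₀' : 0 ≤ A₀ := ha₀.trans haA
  set β := b₀ / (1 - a₀) with hβ
  set B₁ := B₀ / (1 - A₀) with hB₁
  have hβ₀ : 0 < β := div_pos hb₀ h1a
  have hB₁₀ : 0 < B₁ := div_pos hB₀ h1A
  let q : ℝ → ℝ := fun γ => A₀ * Real.exp (γ * σ)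
  -- The loop gain at rate `γ`; `κ 0` is the left side of `hmain`.
  let κ : ℝ → ℝ := fun γ => q γ * (B₁ * (σ * (B₀ / (1 - q γ)))) / (1 - q γ) / (β - γ)
  have hqc : Continuous q := by fun_prop
  have hq0 : q 0 = A₀ := by simp [q]
  have hκ0 : κ 0 < 1 := by
    have : κ 0 = σ * A₀ * B₀ ^ 2 * (1 - a₀) / ((1 - A₀) ^ 3 * b₀) := by
      simp only [κ, hq0, hβ, hB₁, sub_zero]
      field_simp
    rwa [this]
  have hκc : ContinuousAt κ 0 := by
    have h1 : 1 - q 0 ≠ 0 := by rw [hq0]; exact h1A.ne'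
    have h2 : β - 0 ≠ 0 := by rw [sub_zero]; exact hβ₀.ne'
    have := hqc.continuousAt (x := 0)
    exact ContinuousAt.div (ContinuousAt.div (by fun_prop (disch := assumption)) (by fun_prop) h1)
      (by fun_prop) h2
  have hev : ∀ᶠ γ in nhds (0 : ℝ), κ γ < 1 ∧ q γ < 1 ∧ γ < β :=
    (hκc.eventually_lt continuousAt_const hκ0).and
      ((hqc.continuousAt.eventually_lt continuousAt_const (by rw [hq0]; exact hA₀)).and
        (eventually_lt_nhds hβ₀))
  obtain ⟨γ, ⟨hκ, hq, hγβ⟩, hγ⟩ :=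
    ((hev.filter_mono nhdsWithin_le_nhds).and (self_mem_nhdsWithin (s := Ioi (0 : ℝ)))).exists
  have hγ₀ : 0 < γ := hγ
  have h1q : 0 < 1 - q γ := by linarith
  have hβγ : 0 < β - γ := by linarith
  have hqγ : 0 ≤ q γ := by positivity
  -- The coefficient of `Φ` when the three estimates are chained.
  let N : ℝ := 1 + q γ * (B₁ * (σ * (q γ / (1 - q γ))) + (1 + B₁)) / (1 - q γ) / (β - γ)
  have hN : 0 < N := by positivity
  refine ⟨N / (1 - κ γ), γ, div_pos hN (by linarith), hγ₀, ?_⟩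
  intro t₀ ht₀ φ ψ _ _ hφb hψb x hx t₁ ht₁
  obtain ⟨Cφ, hCφ⟩ := hφb
  obtain ⟨Cψ, hCψ⟩ := hψb
  set Φ := ⨆ s : Iic t₀, (|φ s| + |(Iio t₀).indicator ψ s|)
  have hle : ∀ s, s ≤ t₀ → |φ s| + |(Iio t₀).indicator ψ s| ≤ Φ := by
    intro s hs
    refine le_ciSup (f := fun s : Iic t₀ => |φ s| + |(Iio t₀).indicator ψ s|)
      ⟨Cφ + |Cψ|, ?_⟩ ⟨s, hs⟩
    rintro _ ⟨r, rfl⟩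
    refine add_le_add (hCφ r r.2) ?_
    by_cases hr : (r : ℝ) ∈ Iio t₀
    · rw [indicator_of_mem hr]
      exact (hCψ r hr).trans (le_abs_self _)
    · rw [indicator_of_notMem hr, abs_zero]
      exact abs_nonneg _
  have hφ : |φ t₀| ≤ Φ := le_of_add_le_of_nonneg_left (hle t₀ le_rfl) (abs_nonneg _)
  have hψ : ∀ s, s < t₀ → |ψ s| ≤ Φ := by
    intro s hs
    have := hle s hs.le
    rw [indicator_of_mem (show s ∈ Iio t₀ from hs)] at this
    linarith [abs_nonneg (φ s)]
  have hΦ₀ : 0 ≤ Φ := (abs_nonneg _).trans hφ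
  have hac := hx.absolutelyContinuous t₁ ht₁
  have hcont : ContinuousOn (fun t => Real.exp (γ * (t - t₀)) * |x t|) (Icc t₀ t₁) := by
    have : ContinuousOn x (Icc t₀ t₁) := by simpa [uIcc_of_le ht₁] using hac.continuousOn
    fun_prop
  -- The maximum `X` over a compact interval is finite, so estimating at `τ` gives `X ≤ κ γ * X + N
  -- * Φ`, which can be solved for `X` with constants independent of `t₁`.
  obtain ⟨τ, hτ, hτmax⟩ := isCompact_Icc.exists_isMaxOn ⟨t₀, le_refl t₀, ht₁⟩ hcont
  set X := Real.exp (γ * (τ - t₀)) * |x τ| with hXdef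
  have hX : ∀ t ∈ Icc t₀ t₁, Real.exp (γ * (t - t₀)) * |x t| ≤ X := fun t ht => hτmax ht
  have hX₀ : 0 ≤ X := by positivity
  have ha' : ∀ t, t₀ ≤ t → a₀ ≤ a t ∧ a t ≤ A₀ := fun t ht => ha t (ht₀.trans ht)
  have hb' : ∀ t, t₀ ≤ t → b₀ ≤ b t ∧ b t ≤ B₀ := fun t ht => hb t (ht₀.trans ht)
  have ha'' : ∀ t, t₀ ≤ t → 0 ≤ a t ∧ a t ≤ A₀ := fun t ht =>
    ⟨ha₀.trans (ha' t ht).1, (ha' t ht).2⟩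
  have hb'' : ∀ t, t₀ ≤ t → 0 ≤ b t ∧ b t ≤ B₀ := fun t ht =>
    ⟨hb₀.le.trans (hb' t ht).1, (hb' t ht).2⟩
  have hg' : ∀ t, t₀ ≤ t → 0 ≤ t - g t ∧ t - g t ≤ σ := fun t ht => hg t (ht₀.trans ht)
  obtain ⟨B, hBeq, hBbd⟩ := exists_bounded_solution_functional_equation (g := g) ha₀ hA₀ ha' hb₀ hb'
  rw [← hβ, ← hB₁] at hBbd
  have hY := hx.ae_exp_mul_deriv_le (hT.trans ht₀) ha'' hb'' hg_null hg' hγ₀.le hq ht₁ hψ hX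
  set Y := (B₀ * X + A₀ * Real.exp (γ * σ) * Φ) / (1 - A₀ * Real.exp (γ * σ)) with hYdef
  have hY₀ : 0 ≤ Y := div_nonneg (by positivity) h1q.le
  have hW := hx.ae_exp_mul_deriv_add_le (hT.trans ht₀) ha'' hg_null hg' hγ₀.le hq ht₁ hφ hψ
    hX hY₀ hY hBeq fun t => ⟨hβ₀.le.trans (hBbd t).1, (hBbd t).2⟩
  have hτb := abs_exp_mul_le_of_ae_deriv hτ.1
    (hac.mono (by rw [uIcc_of_le ht₁, uIcc_of_le hτ.1]; exact Icc_subset_Icc_right hτ.2)) hγβ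
    (by rwa [hx.initial t₀ le_rfl]) hΦ₀ (div_nonneg (by positivity) h1q.le)
    (fun t _ => (hBbd t).1)
    (ae_restrict_of_ae_restrict_of_subset (Icc_subset_Icc_right hτ.2) hW)
  rw [abs_mul, abs_of_pos (Real.exp_pos _), ← hXdef] at hτb
  have hXle : X ≤ κ γ * X + N * Φ := by
    refine hτb.trans_eq ?_
    have h1 : 1 - A₀ * Real.exp (γ * σ) ≠ 0 := h1q.ne'
    have h2 : β - γ ≠ 0 := hβγ.ne'
    simp only [hYdef, κ, N, q]
    field_simp
    ring
  have hXN : X ≤ N * Φ / (1 - κ γ) := by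
    rw [le_div_iff₀ (by linarith)]
    linarith
  have hfin := (hX t₁ ⟨ht₁, le_rfl⟩).trans hXN
  calc |x t₁| = Real.exp (-γ * (t₁ - t₀)) * (Real.exp (γ * (t₁ - t₀)) * |x t₁|) := by
        rw [← mul_assoc, ← Real.exp_add]; simp
    _ ≤ Real.exp (-γ * (t₁ - t₀)) * (N * Φ / (1 - κ γ)) := by gcongr
    _ = N / (1 - κ γ) * Real.exp (-γ * (t₁ - t₀)) * Φ := by ring
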